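/- **Setting.** All objects are smooth. A *globally framed $f$-structure* (g.f.f-structure) on a manifold $\bar M$ of dimension $2n+r$ ($n,r\ge 1$) consists of a $(1,1)$-tensor field $\bar\varphi$ of constant rank $2n$, global vector fields $\bar\xi_1,\dots,\bar\xi_r$ framing $\ker\bar\varphi$, and $1$-forms $\bar\eta^1,\dots,\bar\eta^r$ with $\bar\eta^\alpha(\bar\xi_\beta)=\delta^\alpha_\beta$ and $\bar\varphi^2=-I+\sum_\alpha\bar\eta^\alpha\otimes\bar\xi_\alpha$. It is an *indefinite metric g.f.f-structure* if $\bar g$ is a semi-Riemannian metric of index $\nu$, $0<\nu<2n+r$, with $$\bar g(\bar\varphi X,\bar\varphi Y)=\bar g(X,Y)-\sum_\alpha\varepsilon_\alpha\bar\eta^\alpha(X)\bar\eta^\alpha(Y),$$ where $\varepsilon_\alpha=1$ if $\bar\xi_\alpha$ is spacelike and $\varepsilon_\alpha=-1$ if $\bar\xi_\alpha$ is timelike. $\bar M$ is an *indefinite $\mathcal S$-manifold* if moreover $N_{\bar\varphi}+2\sum_\alpha d\bar\eta^\alpha\otimes\bar\xi_\alpha=0$ ($N_{\bar\varphi}$ the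 Nijenhuis torsion of $\bar\varphi$) and $d\bar\eta^\alpha=\Phi$ for every $\alpha$, where $\Phi(X,Y)=\bar g(X,\bar\varphi Y)$ and $2\,d\eta(X,Y)=X\eta(Y)-Y\eta(X)-\eta([X,Y])$. An *indefinite $\mathcal S$-space form* $\bar M(c)$ is an indefinite $\mathcal S$-manifold of constant $\bar\varphi$-sectional curvature $c\in\mathbb R$: for every $x\in \bar M$ and every $X\in\operatorname{Im}\bar\varphi_x$ with $\bar g(X,X)\ne0$, the plane spanned by $X$ and $\bar\varphi X$ has sectional curvature $c$ with respect to the Levi-Civita connection $\bar\nabla$ of $\bar g$. A *lightlike hypersurface* $M$ of $\bar M$ is a (non-empty, immersed) submanifold of codimension one on which the induced metric $g$ is degenerate at every point; it is *characteristic* if every $\bar\xi_\alpha$ is tangent to $M$. Let $S(TM)$ be a screen distribution, i.e. a smooth distribution with $TM=\operatorname{Rad}(TM)\oplus S(TM)$. For a local nowhere zero section $E$ of $\operatorname{Rad}(TM)$ let $N$ be the unique local section of $T\bar M|_M$ with $\bar g(N,E)=1$, $\bar g(N,N)=0$ and $\bar g(N,W)=0$ for all $W\in S(TM)$, and let $B$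 be defined by the Gauss equation $\bar\nabla_XY=\nabla_XY+B(X,Y)N$ with $\nabla_XY$ tangent to $M$. $M$ is *totally umbilical* if locally $B(X,Y)=\rho\,g(X,Y)$ for some smooth function $\rho$ and all $X,Y$ tangent to $M$. **Theorem.** Let $\bar M(c)$ be an indefinite $\mathcal S$-space form and let $M$ be a characteristic lightlike hypersurface of $\bar M(c)$, with a screen distribution $S(TM)$. If $M$ is totally umbilical, then $$c=\varepsilon:=\sum_{\alpha=1}^r\varepsilon_\alpha .$$ Consequently, if $c\neq\varepsilon$, then $\bar M(c)$ has no totally umbilical characteristic lightlike hypersurface. -/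

import Mathlib

open Set Filter Topology Bundle Module
open scoped Manifold ContDiff

noncomputable section

namespace LightlikeSForm

section Ambient

variable (E : Type*) [NormedAddCommGroup E] [NormedSpace ℝ E]
  (M : Type*) [TopologicalSpace M] [ChartedSpace E M]

/-- (Not necessarily continuous) vector fields on a manifold `M` modelled on `E`. -/
abbrev VField : Type _ := (x : M) → TangentSpace 𝓘(ℝ, E) x

variable {E M}

/-- The vector field `X` is smooth at the point `x`. -/
def SmoothAt [IsManifold 𝓘(ℝ, E) ∞ M] (X : VField E M) (x : M) : Prop :=
  ContMDiffAt 𝓘(ℝ, E) 𝓘(ℝ, E).tangent ∞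
    (fun y => (TotalSpace.mk' E y (X y) : TangentBundle 𝓘(ℝ, E) M)) x

/-- The derivative `X f` of a real function `f` in the direction of a vector field `X`. -/
def lieDer (X : VField E M) (f : M → ℝ) (x : M) : ℝ :=
  mvfderiv 𝓘(ℝ, E) f x (X x)

/-- The Lie bracket `[X, Y]` of vector fields. -/
def bracket (X Y : VField E M) : VField E M :=
  fun x => VectorField.mlieBracket 𝓘(ℝ, E) X Y x

variable (E M)

/-- A smooth semi-Riemannian metric of constant index `ν`: a smooth field of nondegenerate
symmetric bilinear forms such that, at every point, `ν` is the largest dimension of a subspace on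
which the form is negative definite. -/
structure SemiRiemannianMetric [IsManifold 𝓘(ℝ, E) ∞ M] (ν : ℕ) where
  val : (x : M) → TangentSpace 𝓘(ℝ, E) x →L[ℝ] TangentSpace 𝓘(ℝ, E) x →L[ℝ] ℝ
  symm : ∀ x v w, val x v w = val x w v
  nondegenerate : ∀ x v, (∀ w, val x v w = 0) → v = 0
  index_eq : ∀ x, IsGreatest
    {k : ℕ | ∃ W : Submodule ℝ (TangentSpace 𝓘(ℝ, E) x),
      finrank ℝ W = k ∧ ∀ w ∈ W, w ≠ 0 → val x w w < 0} ν
  smooth : ContMDiff 𝓘(ℝ, E) (𝓘(ℝ, E).prod 𝓘(ℝ, E →L[ℝ] E →L[ℝ] ℝ)) ∞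
    (fun x => TotalSpace.mk' (E →L[ℝ] E →L[ℝ] ℝ)
      (E := fun x => TangentSpace 𝓘(ℝ, E) x →L[ℝ] TangentSpace 𝓘(ℝ, E) x →L[ℝ] ℝ) x (val x))

variable {E M}

section LeviCivita

variable [IsManifold 𝓘(ℝ, E) ∞ M] {ν : ℕ} (g : SemiRiemannianMetric E M ν)

/-- The function `g(X, Y)`. -/
def SemiRiemannianMetric.inner (X Y : VField E M) : M → ℝ := fun x => g.val x (X x) (Y x)

/-- The right-hand side of the Koszul formula for `2 g(∇_X Y, Z)`. -/
def SemiRiemannianMetric.koszul (X Y Z : VField E M) (x : M) : ℝ :=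
  lieDer X (g.inner Y Z) x + lieDer Y (g.inner Z X) x - lieDer Z (g.inner X Y) x
    + g.inner (bracket X Y) Z x - g.inner (bracket Y Z) X x + g.inner (bracket Z X) Y x

/-- The Levi-Civita connection: `g.nabla Y x v` is `∇_v Y` for a tangent vector `v` at `x` and a
vector field `Y` that is smooth at `x`, that is, the vector at `x` which the Koszul formula
determines: `2 g(∇_v Y, Z) = koszul(X, Y, Z)` for all fields `X`, `Z` smooth at `x` with
`X x = v`. -/
def SemiRiemannianMetric.nabla (Y : VField E M) (x : M) (v : TangentSpace 𝓘(ℝ, E) x) :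
    TangentSpace 𝓘(ℝ, E) x :=
  Classical.epsilon fun w : TangentSpace 𝓘(ℝ, E) x =>
    ∀ X Z : VField E M, SmoothAt X x → SmoothAt Z x → X x = v →
      2 * g.val x w (Z x) = g.koszul X Y Z x

theorem SemiRiemannianMetric.inner_mdifferentiableAt {X Y : VField E M} {x : M}
    (hX : MDifferentiableAt 𝓘(ℝ, E) 𝓘(ℝ, E).tangent
      (fun y => (TotalSpace.mk' E y (X y) : TangentBundle 𝓘(ℝ, E) M)) x)
    (hY : MDifferentiableAt 𝓘(ℝ, E) 𝓘(ℝ, E).tangent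
      (fun y => (TotalSpace.mk' E y (Y y) : TangentBundle 𝓘(ℝ, E) M)) x) :
    MDifferentiableAt 𝓘(ℝ, E) 𝓘(ℝ, ℝ) (g.inner X Y) x := by
  have : MDifferentiableAt 𝓘(ℝ, E) (𝓘(ℝ, E).prod 𝓘(ℝ))
      (fun m ↦ TotalSpace.mk' ℝ (E := Bundle.Trivial M ℝ) m (g.val m (X m) (Y m))) x := by
    apply MDifferentiableAt.clm_bundle_apply₂ (F₁ := E) (F₂ := E)
    · exact (g.smooth x).mdifferentiableAt (by simp)
    · exact hX
    · exact hY
  rw [mdifferentiableAt_totalSpace] at this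
  exact this.2

theorem SemiRiemannianMetric.koszul_tensorial_right [FiniteDimensional ℝ E] {X Y : VField E M} {x : M}
    (hX : MDifferentiableAt 𝓘(ℝ, E) 𝓘(ℝ, E).tangent
      (fun y => (TotalSpace.mk' E y (X y) : TangentBundle 𝓘(ℝ, E) M)) x)
    (hY : MDifferentiableAt 𝓘(ℝ, E) 𝓘(ℝ, E).tangent
      (fun y => (TotalSpace.mk' E y (Y y) : TangentBundle 𝓘(ℝ, E) M)) x) :
    TensorialAt 𝓘(ℝ, E) E (fun Z => g.koszul X Y Z x) x where
  smul := by
    intro f Z hf hZ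
    have e1 : g.inner Y (f • Z) = f * g.inner Y Z := by
      funext y; simp [SemiRiemannianMetric.inner]
    have e2 : g.inner (f • Z) X = f * g.inner Z X := by
      funext y; simp [SemiRiemannianMetric.inner]
    have b1 : bracket Y (f • Z) x = _ := VectorField.mlieBracket_smul_right hf hZ
    have b2 : bracket (f • Z) X x = _ := VectorField.mlieBracket_smul_left hf hZ
    simp only [SemiRiemannianMetric.koszul, e1, e2, lieDer]
    rw [mvfderiv_mul hf (g.inner_mdifferentiableAt hY hZ), mvfderiv_mul hf (g.inner_mdifferentiableAt hZ hX)]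
    simp only [SemiRiemannianMetric.inner, b1, b2]
    have := g.symm x (Z x) (Y x)
    simp [bracket, this]
    ring
  add := by
    intro Z Z' hZ hZ'
    have e1 : g.inner Y (Z + Z') = g.inner Y Z + g.inner Y Z' := by
      funext y; simp [SemiRiemannianMetric.inner]
    have e2 : g.inner (Z + Z') X = g.inner Z X + g.inner Z' X := by
      funext y; simp [SemiRiemannianMetric.inner]
    have b1 : bracket Y (Z + Z') x = _ := VectorField.mlieBracket_add_right hZ hZ'
    have b2 : bracket (Z + Z') X x = _ := VectorField.mlieBracket_add_left hZ hZ'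
    simp only [SemiRiemannianMetric.koszul, e1, e2, lieDer]
    rw [mvfderiv_add (g.inner_mdifferentiableAt hY hZ) (g.inner_mdifferentiableAt hY hZ'), mvfderiv_add (g.inner_mdifferentiableAt hZ hX) (g.inner_mdifferentiableAt hZ' hX)]
    simp only [SemiRiemannianMetric.inner, b1, b2]
    simp [bracket]
    ring

theorem SemiRiemannianMetric.koszul_tensorial_left [FiniteDimensional ℝ E] {Z Y : VField E M} {x : M}
    (hZ : MDifferentiableAt 𝓘(ℝ, E) 𝓘(ℝ, E).tangent
      (fun y => (TotalSpace.mk' E y (Z y) : TangentBundle 𝓘(ℝ, E) M)) x)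
    (hY : MDifferentiableAt 𝓘(ℝ, E) 𝓘(ℝ, E).tangent
      (fun y => (TotalSpace.mk' E y (Y y) : TangentBundle 𝓘(ℝ, E) M)) x) :
    TensorialAt 𝓘(ℝ, E) E (fun X => g.koszul X Y Z x) x where
  smul := by
    intro f X hf hX
    have e1 : g.inner Z (f • X) = f * g.inner Z X := by
      funext y; simp [SemiRiemannianMetric.inner]
    have e2 : g.inner (f • X) Y = f * g.inner X Y := by
      funext y; simp [SemiRiemannianMetric.inner]
    have b1 : bracket Z (f • X) x = _ := VectorField.mlieBracket_smul_right hf hX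
    have b2 : bracket (f • X) Y x = _ := VectorField.mlieBracket_smul_left hf hX
    simp only [SemiRiemannianMetric.koszul, e1, e2, lieDer]
    rw [mvfderiv_mul hf (g.inner_mdifferentiableAt hX hY), mvfderiv_mul hf (g.inner_mdifferentiableAt hZ hX)]
    simp only [SemiRiemannianMetric.inner, b1, b2]
    have := g.symm x (Z x) (X x)
    simp [bracket, this]
    ring
  add := by
    intro X X' hX hX'
    have e1 : g.inner Z (X + X') = g.inner Z X + g.inner Z X' := by
      funext y; simp [SemiRiemannianMetric.inner]
    have e2 : g.inner (X + X') Y = g.inner X Y + g.inner X' Y := by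
      funext y; simp [SemiRiemannianMetric.inner]
    have b1 : bracket Z (X + X') x = _ := VectorField.mlieBracket_add_right hX hX'
    have b2 : bracket (X + X') Y x = _ := VectorField.mlieBracket_add_left hX hX'
    simp only [SemiRiemannianMetric.koszul, e1, e2, lieDer]
    rw [mvfderiv_add (g.inner_mdifferentiableAt hX hY) (g.inner_mdifferentiableAt hX' hY), mvfderiv_add (g.inner_mdifferentiableAt hZ hX) (g.inner_mdifferentiableAt hZ hX')]
    simp only [SemiRiemannianMetric.inner, b1, b2]
    simp [bracket]
    ring

/-- The vector `∇_v Y` exists, i.e. the definition of `nabla` picks a vector satisfying the Koszul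
formula (it is unique since `g` is nondegenerate). -/
theorem SemiRiemannianMetric.nabla_spec [FiniteDimensional ℝ E] {Y : VField E M} {x : M} (hY : SmoothAt Y x) (v : TangentSpace 𝓘(ℝ, E) x) :
    ∀ X Z : VField E M, SmoothAt X x → SmoothAt Z x → X x = v →
      2 * g.val x (g.nabla Y x v) (Z x) = g.koszul X Y Z x := by
  have md {X : VField E M} (h : SmoothAt X x) :
    MDifferentiableAt 𝓘(ℝ, E) 𝓘(ℝ, E).tangent (fun y => (TotalSpace.mk' E y (X y) : TangentBundle 𝓘(ℝ, E) M)) x :=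
    ContMDiffAt.mdifferentiableAt h (by simp)
  let T := TensorialAt.mkHom₂ (I := 𝓘(ℝ, E)) (F := E) (F' := E)
    (fun X Z : VField E M => g.koszul X Y Z x) x
    (fun Z hZ => g.koszul_tensorial_left hZ (md hY)) (fun X hX => g.koszul_tensorial_right hX (md hY))
  have hT : ∀ X Z, SmoothAt X x → SmoothAt Z x → T (X x) (Z x) = g.koszul X Y Z x :=
    fun X Z hX hZ => TensorialAt.mkHom₂_apply _ _ (md hX) (md hZ)
  have : FiniteDimensional ℝ (TangentSpace 𝓘(ℝ, E) x) := inferInstanceAs (FiniteDimensional ℝ E)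
  let G : TangentSpace 𝓘(ℝ, E) x →ₗ[ℝ] Module.Dual ℝ (TangentSpace 𝓘(ℝ, E) x) :=
    { toFun := fun w => (g.val x w).toLinearMap
      map_add' := by intros; ext; simp
      map_smul' := by intros; ext; simp }
  have hG : Function.Injective G := by
    rw [injective_iff_map_eq_zero]
    intro w hw
    exact g.nondegenerate x w fun z => congrArg (fun l => l z) hw
  obtain ⟨w, hw⟩ := (LinearMap.injective_iff_surjective_of_finrank_eq_finrank
    (Subspace.dual_finrank_eq).symm).1 hG ((1/2 : ℝ) • (T v).toLinearMap)
  have key : ∃ w : TangentSpace 𝓘(ℝ, E) x, ∀ X Z : VField E M, SmoothAt X x → SmoothAt Z x →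
      X x = v → 2 * g.val x w (Z x) = g.koszul X Y Z x := by
    refine ⟨w, fun X Z hX hZ hv => ?_⟩
    have : g.val x w (Z x) = (1/2 : ℝ) * T v (Z x) := congrArg (fun l => l (Z x)) hw
    rw [this, ← hT X Z hX hZ, hv]; ring
  exact Classical.epsilon_spec key
/-- The field `∇_X Y`. -/
def SemiRiemannianMetric.nablaField (X Y : VField E M) : VField E M :=
  fun x => g.nabla Y x (X x)

/-- The curvature `R(X, Y) Z = ∇_X ∇_Y Z - ∇_Y ∇_X Z - ∇_[X,Y] Z`. -/
def SemiRiemannianMetric.curvature (X Y Z : VField E M) : VField E M :=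
  fun x => g.nablaField X (g.nablaField Y Z) x - g.nablaField Y (g.nablaField X Z) x
    - g.nablaField (bracket X Y) Z x

/-- The sectional curvature `g(R(X, Y)Y, X) / (g(X, X) g(Y, Y) - g(X, Y)²)` of the plane spanned
by `X` and `Y` at `x` (meaningful when this plane is nondegenerate). -/
def SemiRiemannianMetric.sectional (X Y : VField E M) (x : M) : ℝ :=
  g.inner (g.curvature X Y Y) X x
    / (g.inner X X x * g.inner Y Y x - g.inner X Y x ^ 2)

end LeviCivita

variable (E M)

/-- A globally framed `f`-structure (g.f.f-structure) on a manifold of dimension `2n + r`: a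
smooth `(1,1)`-tensor field `φ`, not zero (`0 < n`) and of constant rank `2n`, whose kernel is
framed by global vector fields `ξ_1, …, ξ_r` with dual `1`-forms `η^1, …, η^r`, such that
`φ² = -I + Σ η^α ⊗ ξ_α` and `η^α(ξ_β) = δ^α_β`. -/
structure GFFStructure [IsManifold 𝓘(ℝ, E) ∞ M] (n r : ℕ) where
  n_pos : 0 < n
  r_pos : 0 < r
  dim_eq : finrank ℝ E = 2 * n + r
  φ : (x : M) → TangentSpace 𝓘(ℝ, E) x →L[ℝ] TangentSpace 𝓘(ℝ, E) x
  ξ : Fin r → VField E M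
  η : Fin r → (x : M) → TangentSpace 𝓘(ℝ, E) x →L[ℝ] ℝ
  φ_smooth : ContMDiff 𝓘(ℝ, E) (𝓘(ℝ, E).prod 𝓘(ℝ, E →L[ℝ] E)) ∞
    (fun x => TotalSpace.mk' (E →L[ℝ] E)
      (E := fun x => TangentSpace 𝓘(ℝ, E) x →L[ℝ] TangentSpace 𝓘(ℝ, E) x) x (φ x))
  ξ_smooth : ∀ α x, SmoothAt (ξ α) x
  η_smooth : ∀ α, ContMDiff 𝓘(ℝ, E) (𝓘(ℝ, E).prod 𝓘(ℝ, E →L[ℝ] ℝ)) ∞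
    (fun x => TotalSpace.mk' (E →L[ℝ] ℝ)
      (E := fun x => TangentSpace 𝓘(ℝ, E) x →L[ℝ] ℝ) x (η α x))
  rank_eq : ∀ x, finrank ℝ (LinearMap.range (φ x).toLinearMap) = 2 * n
  ker_eq : ∀ x, LinearMap.ker (φ x).toLinearMap = Submodule.span ℝ (Set.range fun α => ξ α x)
  φ_sq : ∀ x v, φ x (φ x v) = -v + ∑ α, η α x v • ξ α x
  η_ξ : ∀ α β x, η α x (ξ β x) = if α = β then 1 else 0

/-- An indefinite metric g.f.f-structure: a g.f.f-structure with a semi-Riemannian metric `g` of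
index `ν`, `0 < ν < 2n + r`, such that `g(φX, φY) = g(X, Y) - Σ ε_α η^α(X) η^α(Y)`, where
`ε_α = ±1` according to whether `ξ_α` is spacelike or timelike. -/
structure IndefiniteMetricGFF [IsManifold 𝓘(ℝ, E) ∞ M] (n r : ℕ) extends
    GFFStructure E M n r where
  ν : ℕ
  ν_pos : 0 < ν
  ν_lt : ν < 2 * n + r
  g : SemiRiemannianMetric E M ν
  ε : Fin r → ℝ
  ε_spec : ∀ α x, (0 < g.val x (ξ α x) (ξ α x) ∧ ε α = 1) ∨
    (g.val x (ξ α x) (ξ α x) < 0 ∧ ε α = -1)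
  compatible : ∀ x v w,
    g.val x (φ x v) (φ x w) = g.val x v w - ∑ α, ε α * η α x v * η α x w

variable {E M}

section SManifold

variable [IsManifold 𝓘(ℝ, E) ∞ M] {n r : ℕ} (Q : IndefiniteMetricGFF E M n r)

/-- The field `φ X`. -/
def IndefiniteMetricGFF.φf (X : VField E M) : VField E M := fun x => Q.φ x (X x)

/-- The function `η^α(X)`. -/
def IndefiniteMetricGFF.ηf (α : Fin r) (X : VField E M) : M → ℝ := fun x => Q.η α x (X x)

/-- The fundamental `2`-form `Φ(X, Y) = g(X, φ Y)`. -/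
def IndefiniteMetricGFF.Φ (X Y : VField E M) : M → ℝ := Q.g.inner X (Q.φf Y)

/-- The exterior derivative of `η^α`, with the convention
`2 dη(X, Y) = X (η(Y)) - Y (η(X)) - η([X, Y])`. -/
def IndefiniteMetricGFF.dη (α : Fin r) (X Y : VField E M) : M → ℝ := fun x =>
  (1 / 2 : ℝ) * (lieDer X (Q.ηf α Y) x - lieDer Y (Q.ηf α X) x - Q.ηf α (bracket X Y) x)

/-- The Nijenhuis torsion
`N_φ(X, Y) = φ²[X, Y] + [φX, φY] - φ[φX, Y] - φ[X, φY]`. -/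
def IndefiniteMetricGFF.nijenhuis (X Y : VField E M) : VField E M := fun x =>
  Q.φf (Q.φf (bracket X Y)) x + bracket (Q.φf X) (Q.φf Y) x
    - Q.φf (bracket (Q.φf X) Y) x - Q.φf (bracket X (Q.φf Y)) x

/-- Indefinite `S`-manifolds: the structure is normal, `N_φ + 2 Σ dη^α ⊗ ξ_α = 0`, and
`dη^α = Φ` for every `α`. -/
structure IndefiniteMetricGFF.IsSManifold : Prop where
  normal : ∀ (X Y : VField E M) (x : M), SmoothAt X x → SmoothAt Y x →
    Q.nijenhuis X Y x + ∑ α, (2 * Q.dη α X Y x) • Q.ξ α x = 0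
  dη_eq : ∀ (α : Fin r) (X Y : VField E M) (x : M), SmoothAt X x → SmoothAt Y x →
    Q.dη α X Y x = Q.Φ X Y x

/-- Indefinite `S`-space forms `M(c)`: indefinite `S`-manifolds of constant `φ`-sectional
curvature `c`, i.e. the plane spanned by `X` and `φX` has sectional curvature `c` for every
non-null vector `X` in the image of `φ`. -/
structure IndefiniteMetricGFF.IsSSpaceForm (c : ℝ) : Prop where
  isSManifold : Q.IsSManifold
  sectional_eq : ∀ (X : VField E M) (x : M), SmoothAt X x →
    X x ∈ LinearMap.range (Q.φ x).toLinearMap → Q.g.inner X X x ≠ 0 →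
    Q.g.sectional X (Q.φf X) x = c

end SManifold

end Ambient

section Hypersurface

variable {E : Type*} [NormedAddCommGroup E] [NormedSpace ℝ E]
  {Mbar : Type*} [TopologicalSpace Mbar] [ChartedSpace E Mbar]
  {F : Type*} [NormedAddCommGroup F] [NormedSpace ℝ F]
  {M : Type*} [TopologicalSpace M] [ChartedSpace F M]

/-- The differential at `p` of a map `i : M → Mbar`. -/
abbrev tmap (E F : Type*) [NormedAddCommGroup E] [NormedSpace ℝ E]
    [NormedAddCommGroup F] [NormedSpace ℝ F]
    {Mbar : Type*} [TopologicalSpace Mbar] [ChartedSpace E Mbar]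
    {M : Type*} [TopologicalSpace M] [ChartedSpace F M]
    (i : M → Mbar) (p : M) : TangentSpace 𝓘(ℝ, F) p →L[ℝ] TangentSpace 𝓘(ℝ, E) (i p) :=
  mfderiv 𝓘(ℝ, F) 𝓘(ℝ, E) i p

variable (E F) in
/-- `i : M → Mbar` is a (possibly only immersed) hypersurface: a smooth immersion of
codimension one. -/
structure IsHypersurface (i : M → Mbar) : Prop where
  smooth : ContMDiff 𝓘(ℝ, F) 𝓘(ℝ, E) ∞ i
  immersion : ∀ p, Function.Injective (tmap E F i p)
  codim : finrank ℝ F + 1 = finrank ℝ E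

variable [IsManifold 𝓘(ℝ, E) ∞ Mbar] {ν : ℕ} (g : SemiRiemannianMetric E Mbar ν) (i : M → Mbar)

/-- The induced (degenerate) metric `g(v, w)` on `T_p M`. -/
def inducedMetric (p : M) (v w : TangentSpace 𝓘(ℝ, F) p) : ℝ :=
  g.val (i p) (tmap E F i p v) (tmap E F i p w)

/-- The radical `Rad(T_p M)` of the induced metric. -/
def radical (p : M) : Submodule ℝ (TangentSpace 𝓘(ℝ, F) p) where
  carrier := {v | ∀ w, inducedMetric g i p v w = 0}
  add_mem' := by
    intro a b ha hb w
    have h1 := ha w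
    have h2 := hb w
    simp only [inducedMetric] at h1 h2 ⊢
    simp [h1, h2]
  zero_mem' := by
    intro w
    simp [inducedMetric]
  smul_mem' := by
    intro a v hv w
    have h1 := hv w
    simp only [inducedMetric] at h1 ⊢
    simp [h1]

variable (F) in
/-- A lightlike hypersurface: the induced metric is degenerate at every point. -/
structure IsLightlikeHypersurface : Prop where
  isHypersurface : IsHypersurface E F i
  degenerate : ∀ p, radical (F := F) g i p ≠ ⊥

variable (F) in
/-- A lightlike hypersurface is characteristic if all the `ξ_α` are tangent to it. -/
structure IsCharacteristic {n r : ℕ} (Q : IndefiniteMetricGFF E Mbar n r) (i : M → Mbar) :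
    Prop where
  isLightlike : IsLightlikeHypersurface F Q.g i
  tangent : ∀ (α : Fin r) (p : M), ∃ v, tmap E F i p v = Q.ξ α (i p)

/-- A smooth distribution on `M`: locally spanned by smooth, pointwise linearly independent vector
fields. -/
def IsSmoothDistribution [IsManifold 𝓘(ℝ, F) ∞ M]
    (S : (p : M) → Submodule ℝ (TangentSpace 𝓘(ℝ, F) p)) : Prop :=
  ∀ p₀ : M, ∃ U : Set M, IsOpen U ∧ p₀ ∈ U ∧ ∃ (k : ℕ) (X : Fin k → VField F M),
    (∀ j, ∀ p ∈ U, SmoothAt (X j) p) ∧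
    ∀ p ∈ U, LinearIndependent ℝ (fun j => X j p) ∧
      Submodule.span ℝ (Set.range fun j => X j p) = S p

/-- A screen distribution: a smooth distribution complementary to the radical one in `TM`. -/
structure IsScreen [IsManifold 𝓘(ℝ, F) ∞ M] (S : (p : M) → Submodule ℝ (TangentSpace 𝓘(ℝ, F) p)) : Prop where
  smooth : IsSmoothDistribution S
  isCompl : ∀ p, IsCompl (radical g i p) (S p)

/-- `Z` is a nowhere zero smooth section of `Rad(TM)` on `U`, and `N` is the corresponding section
of the lightlike transversal bundle `ltr(M)` of the screen `S`:
`g(N, Z) = 1`, `g(N, N) = 0`, and `g(N, W) = 0` for `W` in `S`. -/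
structure IsNullPair [IsManifold 𝓘(ℝ, F) ∞ M]
    (S : (p : M) → Submodule ℝ (TangentSpace 𝓘(ℝ, F) p)) (U : Set M)
    (Z : VField F M) (N : (p : M) → TangentSpace 𝓘(ℝ, E) (i p)) : Prop where
  smooth : ∀ p ∈ U, SmoothAt Z p
  ne_zero : ∀ p ∈ U, Z p ≠ 0
  mem_radical : ∀ p ∈ U, Z p ∈ radical g i p
  inner_NZ : ∀ p ∈ U, g.val (i p) (N p) (tmap E F i p (Z p)) = 1
  inner_NN : ∀ p ∈ U, g.val (i p) (N p) (N p) = 0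
  inner_NS : ∀ p ∈ U, ∀ w ∈ S p, g.val (i p) (N p) (tmap E F i p w) = 0

/-- `Ybar` extends, near `p`, the vector field `Y` on `M` to a vector field on `Mbar` that is
smooth at `i p`. As `i` is an immersion, a field `Y` has such an extension at `p` iff it is smooth
there. -/
structure IsExtensionAt (Y : VField F M) (Ybar : VField E Mbar) (p : M) : Prop where
  smooth : SmoothAt Ybar (i p)
  eq : ∀ᶠ q in 𝓝 p, Ybar (i q) = tmap E F i q (Y q)

/-- `B` is the local second fundamental form of `M` on `U` with respect to the section `N` of
`ltr(M)`, i.e. the Gauss equation `∇bar_X Y = ∇_X Y + B(X, Y) N` with `∇_X Y` tangent to `M`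
holds for the vectors `x = X p` and the (smooth) vector fields `Y` on `U`. The derivative
`∇bar_X Y` of `Y` along `M` is computed by means of any local extension of `Y`. -/
def IsLocalSecondFundamentalForm (U : Set M) (N : (p : M) → TangentSpace 𝓘(ℝ, E) (i p))
    (B : (p : M) → TangentSpace 𝓘(ℝ, F) p → TangentSpace 𝓘(ℝ, F) p → ℝ) : Prop :=
  ∀ p ∈ U, ∀ (x : TangentSpace 𝓘(ℝ, F) p) (Y : VField F M) (Ybar : VField E Mbar),
    IsExtensionAt i Y Ybar p →
    ∃ t : TangentSpace 𝓘(ℝ, F) p,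
      g.nabla Ybar (i p) (tmap E F i p x) = tmap E F i p t + B p x (Y p) • N p

/-- The lightlike hypersurface `M`, with screen `S`, is totally umbilical: locally
`B(X, Y) = ρ g(X, Y)` for some smooth function `ρ`. (Replacing `Z` by another nowhere zero section
of the radical multiplies `B`, hence `ρ`, by a nowhere zero smooth function.) -/
def IsTotallyUmbilical [IsManifold 𝓘(ℝ, F) ∞ M]
    (S : (p : M) → Submodule ℝ (TangentSpace 𝓘(ℝ, F) p)) : Prop :=
  ∀ p₀ : M, ∃ U : Set M, IsOpen U ∧ p₀ ∈ U ∧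
    ∃ (Z : VField F M) (N : (p : M) → TangentSpace 𝓘(ℝ, E) (i p))
      (B : (p : M) → TangentSpace 𝓘(ℝ, F) p → TangentSpace 𝓘(ℝ, F) p → ℝ) (ρ : M → ℝ),
      IsNullPair g i S U Z N ∧ IsLocalSecondFundamentalForm g i U N B ∧
      ContMDiffOn 𝓘(ℝ, F) 𝓘(ℝ, ℝ) ∞ ρ U ∧
      ∀ p ∈ U, ∀ x y, B p x y = ρ p * inducedMetric g i p x y

end Hypersurface

end LightlikeSForm

end

/-!
Let `M` be a characteristic lightlike hypersurface of an indefinite `S`-manifold, `e` a nonzero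
vector of its radical at a point, and `B` its second fundamental form there, so that
`B(v, Y) = g(∇_v Y, e)`.

The point is that the characteristic fields are Killing with `∇_v ξ_α = -ε_α φ v`
(`IndefiniteMetricGFF.IsSManifold.g_nabla_ξ`). Normality and `dη^β = Φ` give `L_ξ η^β = 0` and
`L_ξ φ = 0` for `ξ = ξ_α`, hence `L_ξ Φ = L_ξ dη = d L_ξ η = 0`. In the Koszul formula for
`2 g(∇_X ξ, φ Y)` the terms forming `(L_ξ g)(X, φ Y) = (L_ξ Φ)(X, Y)` cancel and
`2 ε_α dη^α(X, φ Y)` is left.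

As `ξ_α` is tangent to `M`, this yields `B(v, ξ_α) = -ε_α g(φ v, e) = ε_α g(v, φ e)` for all `v`
tangent to `M`. If `B = ρ g`, taking `v = ξ_α` gives `ρ = 0`, as `φ ξ_α = 0`. Therefore `φ e` is
orthogonal to `TM`, whose orthogonal complement is the line of `e`, so `φ e = a e` with `a` real and
`φ² e = a² e`. But `η^β(e) = ε_β g(e, ξ_β) = 0` for all `β`, so `φ² e = -e`, which is impossible.

So the nonexistence asserted for `c ≠ ε` holds whatever the value of `c`
(`IsCharacteristic.not_isTotallyUmbilical`). This comes from the geometry and not from the way in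
which the notions are encoded: a characteristic lightlike hypersurface always has
`B(·, ξ_α) = ε_α g(·, φ e) ≠ 0`, whereas `g(·, ξ_α)` is a multiple of `η^α` and `B(ξ_α, ξ_α) = 0`.
The implication from umbilicity to `c = ε` is the contrapositive of the nonexistence for `c ≠ ε`.
-/

namespace LightlikeSForm

/-! ### Smooth vector fields and brackets -/

section VectorFields

variable {E : Type*} [NormedAddCommGroup E] [NormedSpace ℝ E]
  {M : Type*} [TopologicalSpace M] [ChartedSpace E M]

theorem bracket_swap (X Y : VField E M) (x : M) : bracket X Y x = -bracket Y X x :=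
  VectorField.mlieBracket_swap_apply

theorem lieDer_congr {X : VField E M} {f h : M → ℝ} {x : M} (hfh : f =ᶠ[𝓝 x] h) :
    lieDer X f x = lieDer X h x := by
  simp only [lieDer, mvfderiv, hfh.mfderiv_eq, ContinuousLinearMap.comp_apply]
  rfl

theorem lieDer_const (X : VField E M) (a : ℝ) (x : M) : lieDer X (fun _ => a) x = 0 := by
  simp [lieDer, mvfderiv_const]

theorem lieDer_const_mul {X : VField E M} {f : M → ℝ} {x : M} (a : ℝ)
    (hf : ContMDiffAt 𝓘(ℝ, E) 𝓘(ℝ, ℝ) ∞ f x) :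
    lieDer X (fun y => a * f y) x = a * lieDer X f x := by
  have h := mvfderiv_mul (f := fun _ : M => a) mdifferentiableAt_const
    (hf.mdifferentiableAt (by simp))
  change mvfderiv _ ((fun _ => a) * f) x _ = _
  rw [h]
  simp [lieDer, mvfderiv_const]

theorem lieDer_sub {X : VField E M} {f h : M → ℝ} {x : M}
    (hf : ContMDiffAt 𝓘(ℝ, E) 𝓘(ℝ, ℝ) ∞ f x) (hh : ContMDiffAt 𝓘(ℝ, E) 𝓘(ℝ, ℝ) ∞ h x) :
    lieDer X (fun y => f y - h y) x = lieDer X f x - lieDer X h x := by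
  change mvfderiv _ (f - h) x _ = _
  rw [mvfderiv_sub (hf.mdifferentiableAt (by simp)) (hh.mdifferentiableAt (by simp))]
  rfl

variable [IsManifold 𝓘(ℝ, E) ∞ M]

theorem SmoothAt.mdifferentiableAt {X : VField E M} {x : M} (hX : SmoothAt X x) :
    MDifferentiableAt 𝓘(ℝ, E) 𝓘(ℝ, E).tangent
      (fun y => (TotalSpace.mk' E y (X y) : TangentBundle 𝓘(ℝ, E) M)) x :=
  ContMDiffAt.mdifferentiableAt hX (by simp)

theorem SmoothAt.smul {f : M → ℝ} {X : VField E M} {x : M}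
    (hf : ContMDiffAt 𝓘(ℝ, E) 𝓘(ℝ, ℝ) ∞ f x) (hX : SmoothAt X x) : SmoothAt (f • X) x :=
  ContMDiffAt.smul_section hf hX

/-- Smoothness is required on a whole neighbourhood of `x`: being `C^∞` at a single point does not
propagate to nearby points, where only finite orders of differentiability are available. -/
theorem exists_smooth_extension (x : M) (v : TangentSpace 𝓘(ℝ, E) x) :
    ∃ X : VField E M, X x = v ∧ ∃ U : Set M, IsOpen U ∧ x ∈ U ∧ ∀ y ∈ U, SmoothAt X y := by
  obtain ⟨U, hU, h⟩ := FiberBundle.exists_contMDiffOn_extend (k := ∞) 𝓘(ℝ, E) E v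
  obtain ⟨V, hVU, hV, hx⟩ := mem_nhds_iff.1 hU
  exact ⟨_, FiberBundle.extend_apply_self E v, V, hV, hx,
    fun y hy => (h.contMDiffAt (mem_of_superset (hV.mem_nhds hy) hVU) :)⟩

variable [CompleteSpace E]

theorem SmoothAt.bracket {X Y : VField E M} {x : M}
    (hX : SmoothAt X x) (hY : SmoothAt Y x) : SmoothAt (bracket X Y) x := by
  have : IsManifold 𝓘(ℝ, E) (minSmoothness ℝ 2) M := by
    simp only [minSmoothness_of_isRCLikeNormedField]; infer_instance
  have : IsManifold 𝓘(ℝ, E) (((⊤ : ℕ∞) : ℕ∞ω) + 1) M := ‹IsManifold 𝓘(ℝ, E) ∞ M›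
  exact ContMDiffAt.mlieBracket_vectorField (m := ⊤) (n := ⊤) hX hY (by simp)

theorem bracket_smul_right {X Y : VField E M} {f : M → ℝ} {x : M}
    (hf : ContMDiffAt 𝓘(ℝ, E) 𝓘(ℝ, ℝ) ∞ f x) (hY : SmoothAt Y x) :
    bracket X (f • Y) x = lieDer X f x • Y x + f x • bracket X Y x :=
  VectorField.mlieBracket_smul_right (hf.mdifferentiableAt (by simp)) hY.mdifferentiableAt

theorem bracket_add_right {X Y Z : VField E M} {x : M}
    (hY : SmoothAt Y x) (hZ : SmoothAt Z x) :
    bracket X (Y + Z) x = bracket X Y x + bracket X Z x :=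
  VectorField.mlieBracket_add_right hY.mdifferentiableAt hZ.mdifferentiableAt

theorem bracket_jacobi {X Y Z : VField E M} {x : M}
    (hX : SmoothAt X x) (hY : SmoothAt Y x) (hZ : SmoothAt Z x) :
    bracket X (bracket Y Z) x = bracket (bracket X Y) Z x + bracket Y (bracket X Z) x := by
  have : IsManifold 𝓘(ℝ, E) (minSmoothness ℝ 3) M := by
    simp only [minSmoothness_of_isRCLikeNormedField]; infer_instance
  have h2 : minSmoothness ℝ 2 ≤ ∞ := by
    simp only [minSmoothness_of_isRCLikeNormedField]; norm_cast
  exact VectorField.leibniz_identity_mlieBracket_apply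
    (ContMDiffAt.of_le hX h2) (ContMDiffAt.of_le hY h2) (ContMDiffAt.of_le hZ h2)

end VectorFields

/-! ### The algebra of the structure and functions along its fields -/

section Structure

variable {E : Type*} [NormedAddCommGroup E] [NormedSpace ℝ E]
  {M : Type*} [TopologicalSpace M] [ChartedSpace E M] [IsManifold 𝓘(ℝ, E) ∞ M] {n r : ℕ}

namespace GFFStructure

variable (G : GFFStructure E M n r)

theorem φ_ξ (α : Fin r) (x : M) : G.φ x (G.ξ α x) = 0 := by
  have h : G.ξ α x ∈ LinearMap.ker (G.φ x).toLinearMap := by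
    rw [G.ker_eq]; exact Submodule.subset_span ⟨α, rfl⟩
  exact h

theorem η_sum (x : M) (a : Fin r → ℝ) (α : Fin r) : G.η α x (∑ β, a β • G.ξ β x) = a α := by
  simp [map_sum, G.η_ξ]

theorem η_φ (α : Fin r) (x : M) (v : TangentSpace 𝓘(ℝ, E) x) : G.η α x (G.φ x v) = 0 := by
  -- `φ³ = -φ`, read off once from `φ² (φ v)` and once from `φ (φ² v)`
  have h1 := G.φ_sq x (G.φ x v)
  rw [G.φ_sq x v] at h1
  have h2 : ∑ β, G.η β x (G.φ x v) • G.ξ β x = 0 := by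
    simpa [map_sum, G.φ_ξ] using h1
  rw [← G.η_sum x (fun β => G.η β x (G.φ x v)) α, h2, map_zero]

/-- A vector killed by `φ` and by all the `η^α` vanishes. -/
theorem eq_zero_of_φ_η {x : M} {v : TangentSpace 𝓘(ℝ, E) x} (hφ : G.φ x v = 0)
    (hη : ∀ α, G.η α x v = 0) : v = 0 := by
  have h := G.φ_sq x v
  simpa [hφ, hη] using h

theorem smoothAt_φ {X : VField E M} {x : M} (hX : SmoothAt X x) :
    SmoothAt (fun y => G.φ y (X y)) x :=
  ContMDiffAt.clm_bundle_apply (F₁ := E) (F₂ := E) (G.φ_smooth x) hX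

theorem contMDiffAt_η (α : Fin r) {X : VField E M} {x : M} (hX : SmoothAt X x) :
    ContMDiffAt 𝓘(ℝ, E) 𝓘(ℝ, ℝ) ∞ (fun y => G.η α y (X y)) x := by
  have h : ContMDiffAt 𝓘(ℝ, E) (𝓘(ℝ, E).prod 𝓘(ℝ)) ∞
      (fun y ↦ TotalSpace.mk' ℝ (E := Bundle.Trivial M ℝ) y (G.η α y (X y))) x :=
    ContMDiffAt.clm_bundle_apply (F₁ := E) (F₂ := ℝ) (G.η_smooth α x) hX
  rw [contMDiffAt_totalSpace] at h
  exact h.2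

variable [CompleteSpace E]

/-- The derivative of a function is a component of a bracket, by the Leibniz rule and
`η^α(ξ_α) = 1`. This turns statements on iterated derivatives of functions into statements on
brackets of vector fields. -/
theorem lieDer_eq_η_bracket (α : Fin r) {X : VField E M} {f : M → ℝ} {x : M}
    (hf : ContMDiffAt 𝓘(ℝ, E) 𝓘(ℝ, ℝ) ∞ f x) :
    lieDer X f x = G.η α x (bracket X (f • G.ξ α) x) - f x * G.η α x (bracket X (G.ξ α) x) := by
  rw [bracket_smul_right hf (G.ξ_smooth α x)]
  simp [G.η_ξ]

include G in
theorem contMDiffAt_lieDer {X : VField E M} {f : M → ℝ} {U : Set M} (hU : IsOpen U)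
    (hX : ∀ y ∈ U, SmoothAt X y) (hf : ∀ y ∈ U, ContMDiffAt 𝓘(ℝ, E) 𝓘(ℝ, ℝ) ∞ f y)
    {x : M} (hx : x ∈ U) : ContMDiffAt 𝓘(ℝ, E) 𝓘(ℝ, ℝ) ∞ (lieDer X f) x := by
  let α : Fin r := ⟨0, G.r_pos⟩
  have h : ContMDiffAt 𝓘(ℝ, E) 𝓘(ℝ, ℝ) ∞ (fun y => G.η α y (bracket X (f • G.ξ α) y)
      - f y * G.η α y (bracket X (G.ξ α) y)) x :=
    (G.contMDiffAt_η α ((hX x hx).bracket (.smul (hf x hx) (G.ξ_smooth α x)))).sub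
      ((hf x hx).mul (G.contMDiffAt_η α ((hX x hx).bracket (G.ξ_smooth α x))))
  refine h.congr_of_eventuallyEq ?_
  filter_upwards [hU.mem_nhds hx] with y hy
  exact G.lieDer_eq_η_bracket α (hf y hy)

include G in
/-- `[X, Y] f = X (Y f) - Y (X f)`: this is the `η^α`-component of the Jacobi identity for `X`, `Y`
and `f ξ_α`. -/
theorem lieDer_bracket {X Y : VField E M} {f : M → ℝ} {U : Set M} (hU : IsOpen U)
    (hX : ∀ y ∈ U, SmoothAt X y) (hY : ∀ y ∈ U, SmoothAt Y y)
    (hf : ∀ y ∈ U, ContMDiffAt 𝓘(ℝ, E) 𝓘(ℝ, ℝ) ∞ f y) {x : M} (hx : x ∈ U) :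
    lieDer (bracket X Y) f x = lieDer X (lieDer Y f) x - lieDer Y (lieDer X f) x := by
  let α : Fin r := ⟨0, G.r_pos⟩
  have expand : ∀ X Y : VField E M, (∀ y ∈ U, SmoothAt X y) → (∀ y ∈ U, SmoothAt Y y) →
      G.η α x (bracket X (bracket Y (f • G.ξ α)) x) = lieDer X (lieDer Y f) x
        + lieDer Y f x * G.η α x (bracket X (G.ξ α) x)
        + lieDer X f x * G.η α x (bracket Y (G.ξ α) x)
        + f x * G.η α x (bracket X (bracket Y (G.ξ α)) x) := by
    intro X Y hX hY
    have e : bracket Y (f • G.ξ α) =ᶠ[𝓝 x] lieDer Y f • G.ξ α + f • bracket Y (G.ξ α) := by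
      filter_upwards [hU.mem_nhds hx] with y hy
      exact bracket_smul_right (hf y hy) (G.ξ_smooth α y)
    have hYf := G.contMDiffAt_lieDer hU hY hf hx
    have hb := (hY x hx).bracket (G.ξ_smooth α x)
    have e' : bracket X (bracket Y (f • G.ξ α)) x = _ :=
      (EventuallyEq.refl _ X).mlieBracket_vectorField_eq e
    rw [e']
    change G.η α x (bracket X (lieDer Y f • G.ξ α + f • bracket Y (G.ξ α)) x) = _
    rw [bracket_add_right (.smul hYf (G.ξ_smooth α x)) (.smul (hf x hx) hb),
      bracket_smul_right hYf (G.ξ_smooth α x), bracket_smul_right (hf x hx) hb]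
    simp [G.η_ξ]
    ring
  have hξ := G.ξ_smooth α x
  have J1 := congrArg (G.η α x) (bracket_jacobi (hX x hx) (hY x hx) (.smul (hf x hx) hξ))
  have J2 := congrArg (G.η α x) (bracket_jacobi (hX x hx) (hY x hx) hξ)
  rw [map_add, expand X Y hX hY, expand Y X hY hX] at J1
  rw [map_add] at J2
  rw [G.lieDer_eq_η_bracket α (hf x hx)]
  linear_combination -J1 + f x * J2

end GFFStructure

namespace IndefiniteMetricGFF

variable (Q : IndefiniteMetricGFF E M n r)

theorem ε_mul_self (α : Fin r) (x : M) : Q.ε α * Q.ε α = 1 := by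
  rcases Q.ε_spec α x with ⟨-, h⟩ | ⟨-, h⟩ <;> simp [h]

theorem g_ξ (α : Fin r) (x : M) (v : TangentSpace 𝓘(ℝ, E) x) :
    Q.g.val x v (Q.ξ α x) = Q.ε α * Q.η α x v := by
  have h := Q.compatible x v (Q.ξ α x)
  rw [Q.φ_ξ, map_zero] at h
  simp [Q.η_ξ] at h
  linarith

theorem g_φ_left (x : M) (v w : TangentSpace 𝓘(ℝ, E) x) :
    Q.g.val x (Q.φ x v) w = -Q.g.val x v (Q.φ x w) := by
  have h := Q.compatible x v (Q.φ x w)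
  rw [Q.φ_sq] at h
  simp [Q.η_φ, map_sum, Q.g_ξ] at h
  linarith

end IndefiniteMetricGFF

/-! ### The characteristic fields of an indefinite `S`-manifold -/

namespace IndefiniteMetricGFF.IsSManifold

variable {Q : IndefiniteMetricGFF E M n r} (hS : Q.IsSManifold)
include hS

/-- `L_ξ η^β = 0` for `ξ = ξ_α`, because `dη^β(ξ_α, ·) = Φ(ξ_α, ·) = 0` and `η^β(ξ_α)` is
constant. -/
theorem η_bracket_ξ (α β : Fin r) {X : VField E M} {x : M} (hX : SmoothAt X x) :
    Q.η β x (bracket (Q.ξ α) X x) = lieDer (Q.ξ α) (Q.ηf β X) x := by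
  have h := hS.dη_eq β (Q.ξ α) X x (Q.ξ_smooth α x) hX
  have e : Q.ηf β (Q.ξ α) = fun _ => if β = α then 1 else 0 := funext fun y => Q.η_ξ β α y
  have e0 : Q.g.val x (Q.ξ α x) (Q.φ x (X x)) = 0 := by
    rw [Q.g.symm, Q.g_ξ, Q.η_φ, mul_zero]
  simp only [dη, e, lieDer_const, Φ, SemiRiemannianMetric.inner, φf, e0] at h
  simp only [ηf] at h ⊢
  linarith

/-- `L_ξ φ = 0` for `ξ = ξ_α`: normality shows that `φ` kills `(L_ξ φ) X`, and `L_ξ η^β = 0` that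
every `η^β` does. -/
theorem bracket_ξ_φ (α : Fin r) {X : VField E M} {x : M} (hX : SmoothAt X x) :
    bracket (Q.ξ α) (Q.φf X) x = Q.φ x (bracket (Q.ξ α) X x) := by
  have hφX : SmoothAt (Q.φf X) x := Q.smoothAt_φ hX
  rw [← sub_eq_zero]
  refine Q.eq_zero_of_φ_η ?_ fun β => ?_
  · have h := hS.normal (Q.ξ α) X x (Q.ξ_smooth α x) hX
    have e0 : Q.φf (Q.ξ α) = 0 := funext fun y => Q.φ_ξ α y
    have e1 : bracket (0 : VField E M) (Q.φf X) x = 0 := by simp [bracket]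
    have e2 : bracket (0 : VField E M) X x = 0 := by simp [bracket]
    have e3 : ∀ β, Q.dη β (Q.ξ α) X x = 0 := by
      intro β
      rw [hS.dη_eq β (Q.ξ α) X x (Q.ξ_smooth α x) hX, Φ, SemiRiemannianMetric.inner, φf,
        Q.g.symm, Q.g_ξ, Q.η_φ, mul_zero]
    simp only [nijenhuis, e0, e1, e3] at h
    simp only [φf, e2, map_zero] at h
    rw [map_sub, ← neg_eq_zero]
    simpa [φf] using h
  · have e : Q.ηf β (Q.φf X) = fun _ => 0 := funext fun y => Q.η_φ β y (X y)
    rw [map_sub, Q.η_φ, hS.η_bracket_ξ α β hφX, e, lieDer_const, sub_zero]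

/-- The Lie derivative of `Φ = dη` along `ξ_α` vanishes, being `d (L_ξ η) = 0`. -/
theorem lieDer_ξ_Φ [CompleteSpace E] (α : Fin r) {X Y : VField E M} {U : Set M} (hU : IsOpen U)
    (hX : ∀ y ∈ U, SmoothAt X y) (hY : ∀ y ∈ U, SmoothAt Y y) {x : M} (hx : x ∈ U) :
    lieDer (Q.ξ α) (Q.Φ X Y) x = Q.Φ (bracket (Q.ξ α) X) Y x + Q.Φ X (bracket (Q.ξ α) Y) x := by
  set ξ := Q.ξ α
  have hξ : ∀ y ∈ U, SmoothAt ξ y := fun y _ => Q.ξ_smooth α y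
  have hη : ∀ {W : VField E M}, (∀ y ∈ U, SmoothAt W y) → ∀ y ∈ U,
      ContMDiffAt 𝓘(ℝ, E) 𝓘(ℝ, ℝ) ∞ (Q.ηf α W) y :=
    fun hW y hy => Q.contMDiffAt_η α (hW y hy)
  have hL : ∀ {V : VField E M} {f : M → ℝ}, (∀ y ∈ U, SmoothAt V y) →
      (∀ y ∈ U, ContMDiffAt 𝓘(ℝ, E) 𝓘(ℝ, ℝ) ∞ f y) →
      ContMDiffAt 𝓘(ℝ, E) 𝓘(ℝ, ℝ) ∞ (lieDer V f) x :=
    fun hV hf => Q.contMDiffAt_lieDer hU hV hf hx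
  have hXY : ∀ y ∈ U, SmoothAt (bracket X Y) y := fun y hy => (hX y hy).bracket (hY y hy)
  have hξX : ∀ y ∈ U, SmoothAt (bracket ξ X) y := fun y hy => (hξ y hy).bracket (hX y hy)
  have hξY : ∀ y ∈ U, SmoothAt (bracket ξ Y) y := fun y hy => (hξ y hy).bracket (hY y hy)
  -- `L_ξ η = 0`, as an identity of functions near `x`
  have hLη : ∀ {W : VField E M}, (∀ y ∈ U, SmoothAt W y) →
      Q.ηf α (bracket ξ W) =ᶠ[𝓝 x] lieDer ξ (Q.ηf α W) := fun hW => by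
    filter_upwards [hU.mem_nhds hx] with y hy
    exact hS.η_bracket_ξ α α (hW y hy)
  have e : Q.Φ X Y =ᶠ[𝓝 x] fun y => (1 / 2 : ℝ) *
      (lieDer X (Q.ηf α Y) y - lieDer Y (Q.ηf α X) y - Q.ηf α (bracket X Y) y) := by
    filter_upwards [hU.mem_nhds hx] with y hy
    exact (hS.dη_eq α X Y y (hX y hy) (hY y hy)).symm
  have d1 := hL hX (hη hY)
  have d2 := hL hY (hη hX)
  rw [lieDer_congr e, lieDer_const_mul _ ((d1.sub d2).sub (hη hXY x hx)),
    lieDer_sub (d1.sub d2) (hη hXY x hx), lieDer_sub d1 d2,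
    ← hS.dη_eq α _ Y x (hξX x hx) (hY x hx), ← hS.dη_eq α X _ x (hX x hx) (hξY x hx)]
  simp only [dη]
  rw [lieDer_congr (hLη hX), lieDer_congr (hLη hY),
    Q.lieDer_bracket hU hξ hX (hη hY) hx, Q.lieDer_bracket hU hξ hY (hη hX) hx]
  have J := congrArg (Q.η α x) (bracket_jacobi (hξ x hx) (hX x hx) (hY x hx))
  rw [map_add, hS.η_bracket_ξ α α (hXY x hx)] at J
  simp only [ηf] at J ⊢
  rw [J]
  ring

/-- `∇_v ξ_α = -ε_α φ v`, tested against vectors of the form `φ w`. Since `L_ξ φ = 0` and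
`L_ξ Φ = 0`, the field `ξ_α` satisfies Killing's equation there, and only the term `dη^α = Φ` of
the Koszul formula survives. -/
theorem g_nabla_ξ [FiniteDimensional ℝ E] (α : Fin r) (x : M) (v w : TangentSpace 𝓘(ℝ, E) x) :
    Q.g.val x (Q.g.nabla (Q.ξ α) x v) (Q.φ x w) = -Q.ε α * Q.g.val x (Q.φ x v) (Q.φ x w) := by
  have : CompleteSpace E := FiniteDimensional.complete ℝ E
  -- testing against `φ Y` makes `g(Z, X)` equal to `Φ(X, Y)` for `Z = φ Y`
  obtain ⟨X, rfl, U, hU, hxU, hX⟩ := exists_smooth_extension x v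
  obtain ⟨Y, rfl, V, hV, hxV, hY⟩ := exists_smooth_extension x w
  have hXx := hX x hxU
  have hYx := hY x hxV
  have hφY : SmoothAt (Q.φf Y) x := Q.smoothAt_φ hYx
  have hK := Q.g.nabla_spec (Q.ξ_smooth α x) (X x) X (Q.φf Y) hXx hφY rfl
  have i1 : ∀ W : VField E M, Q.g.inner (Q.ξ α) W = fun y => Q.ε α * Q.ηf α W y := fun W =>
    funext fun y => (Q.g.symm y _ _).trans (Q.g_ξ α y _)
  have i2 : ∀ W : VField E M, Q.g.inner W (Q.ξ α) = fun y => Q.ε α * Q.ηf α W y := fun W =>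
    funext fun y => Q.g_ξ α y _
  have i3 : Q.g.inner (Q.φf Y) X = Q.Φ X Y := funext fun y => Q.g.symm y _ _
  have hΦ := hS.lieDer_ξ_Φ α (hU.inter hV) (fun y hy => hX y hy.1) (fun y hy => hY y hy.2)
    ⟨hxU, hxV⟩
  have hdη := hS.dη_eq α X (Q.φf Y) x hXx hφY
  simp only [SemiRiemannianMetric.koszul, i1, i2, i3] at hK
  rw [lieDer_const_mul (f := Q.ηf α (Q.φf Y)) _ (Q.contMDiffAt_η α hφY),
    lieDer_const_mul (f := Q.ηf α X) _ (Q.contMDiffAt_η α hXx), hΦ] at hK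
  have b1 : Q.g.inner (bracket X (Q.ξ α)) (Q.φf Y) x = -Q.Φ (bracket (Q.ξ α) X) Y x := by
    simp [Φ, SemiRiemannianMetric.inner, bracket_swap X]
  have b2 : Q.g.inner (bracket (Q.ξ α) (Q.φf Y)) X x = Q.Φ X (bracket (Q.ξ α) Y) x := by
    simp only [Φ, SemiRiemannianMetric.inner, φf]
    rw [Q.g.symm]
    congr 1
    exact hS.bracket_ξ_φ α hYx
  have b3 : Q.ηf α (bracket (Q.φf Y) X) x = -Q.ηf α (bracket X (Q.φf Y)) x := by
    simp [ηf, bracket_swap (Q.φf Y)]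
  rw [b1, b2, b3] at hK
  simp only [dη] at hdη
  have hsk := Q.g_φ_left x (X x) (Q.φ x (Y x))
  have hΦ' : Q.Φ X (Q.φf Y) x = Q.g.val x (X x) (Q.φ x (Q.φ x (Y x))) := rfl
  simp only [φf] at hK hdη hΦ'
  rw [hsk]
  linear_combination (1 / 2) * hK + Q.ε α * hdη + Q.ε α * hΦ'

end IndefiniteMetricGFF.IsSManifold

end Structure

/-! ### Lightlike hypersurfaces -/

section Hypersurface

variable {E : Type*} [NormedAddCommGroup E] [NormedSpace ℝ E]
  {Mbar : Type*} [TopologicalSpace Mbar] [ChartedSpace E Mbar] [IsManifold 𝓘(ℝ, E) ∞ Mbar]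
  {F : Type*} [NormedAddCommGroup F] [NormedSpace ℝ F]
  {M : Type*} [TopologicalSpace M] [ChartedSpace F M]

/-- The tangent space of a lightlike hypersurface is the whole orthogonal complement of any
nonzero radical vector: it is contained in it, and both are hyperplanes. -/
theorem IsHypersurface.mem_range_tmap_iff [FiniteDimensional ℝ E] [FiniteDimensional ℝ F] {ν : ℕ}
    {g : SemiRiemannianMetric E Mbar ν} {i : M → Mbar} (hi : IsHypersurface E F i) {p : M}
    {z : TangentSpace 𝓘(ℝ, F) p} (hz : z ∈ radical g i p) (hz0 : z ≠ 0)
    (u : TangentSpace 𝓘(ℝ, E) (i p)) :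
    u ∈ LinearMap.range (tmap E F i p).toLinearMap ↔ g.val (i p) (tmap E F i p z) u = 0 := by
  have : FiniteDimensional ℝ (TangentSpace 𝓘(ℝ, E) (i p)) := ‹FiniteDimensional ℝ E›
  have : FiniteDimensional ℝ (TangentSpace 𝓘(ℝ, F) p) := ‹FiniteDimensional ℝ F›
  let L : Module.Dual ℝ (TangentSpace 𝓘(ℝ, E) (i p)) :=
    (g.val (i p) (tmap E F i p z)).toLinearMap
  have hL : L ≠ 0 := fun h => hz0 <| hi.immersion p <| by
    rw [map_zero]
    exact g.nondegenerate _ _ fun w => congrArg (fun l => l w) h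
  have hle : LinearMap.range (tmap E F i p).toLinearMap ≤ LinearMap.ker L := by
    rintro _ ⟨w, rfl⟩
    exact hz w
  have h1 : finrank ℝ (LinearMap.range (tmap E F i p).toLinearMap) = finrank ℝ F :=
    LinearMap.finrank_range_of_inj (hi.immersion p)
  have h2 : finrank ℝ (LinearMap.ker L) + 1 = finrank ℝ E :=
    Module.Dual.finrank_ker_add_one_of_ne_zero hL
  have h3 := hi.codim
  rw [Submodule.eq_of_le_of_finrank_eq hle (by omega)]
  rfl

variable [IsManifold 𝓘(ℝ, F) ∞ M]

/-- An indefinite `S`-manifold has no totally umbilical characteristic lightlike hypersurface: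
`B(·, ξ_α)` is, up to sign, the form `g(·, φ e)` with `e` spanning the radical. It vanishes on `ξ_α`,
which excludes `B = ρ g` with `ρ ≠ 0`, and it is not zero, since `φ e` is not proportional to `e`,
which excludes `ρ = 0`. -/
theorem IsCharacteristic.not_isTotallyUmbilical [FiniteDimensional ℝ E] [FiniteDimensional ℝ F]
    [Nonempty M] {n r : ℕ} {Q : IndefiniteMetricGFF E Mbar n r} (hS : Q.IsSManifold) {i : M → Mbar}
    (hM : IsCharacteristic F Q i) (S : (p : M) → Submodule ℝ (TangentSpace 𝓘(ℝ, F) p)) :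
    ¬ IsTotallyUmbilical Q.g i S := by
  intro hU
  obtain ⟨p⟩ := ‹Nonempty M›
  obtain ⟨U, -, hp, Z, N, B, ρ, hN, hB, -, hρ⟩ := hU p
  have hi := hM.isLightlike.isHypersurface
  let α : Fin r := ⟨0, Q.r_pos⟩
  set e := tmap E F i p (Z p) with he
  have hrad : ∀ w, Q.g.val (i p) e (tmap E F i p w) = 0 := hN.mem_radical p hp
  have he0 : e ≠ 0 := fun h => hN.ne_zero p hp (hi.immersion p (by rw [← he, h, map_zero]))
  have hηe : ∀ β, Q.η β (i p) e = 0 := by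
    intro β
    obtain ⟨v, hv⟩ := hM.tangent β p
    have h := hrad v
    rw [hv, Q.g_ξ] at h
    have hε := Q.ε_mul_self β (i p)
    linear_combination Q.ε β * h - Q.η β (i p) e * hε
  have hφφe : Q.φ (i p) (Q.φ (i p) e) = -e := by simp [Q.φ_sq, hηe]
  -- `B(v, ξ_α) = g(∇_v ξ_α, e) = -ε_α g(φ v, e)`, so umbilicity reads as follows
  have key : ∀ v, -Q.ε α * Q.g.val (i p) (Q.φ (i p) (tmap E F i p v)) e
      = ρ p * Q.g.val (i p) (tmap E F i p v) (Q.ξ α (i p)) := by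
    intro v
    choose Y hY using hM.tangent α
    obtain ⟨t, ht⟩ := hB p hp v Y (Q.ξ α) ⟨Q.ξ_smooth α (i p), .of_forall fun q => (hY q).symm⟩
    have h1 := hS.g_nabla_ξ α (i p) (tmap E F i p v) (-Q.φ (i p) e)
    have h2 := hN.inner_NZ p hp
    rw [map_neg, hφφe, neg_neg, ht, hρ p hp, inducedMetric, hY, map_add, map_smul] at h1
    simp only [add_apply, smul_apply, smul_eq_mul] at h1
    rw [← he] at h2
    rw [Q.g.symm, hrad, h2] at h1
    linarith
  have hε := Q.ε_mul_self α (i p)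
  -- evaluating on `ξ_α` itself, which `φ` kills, gives `ρ = 0`
  have hρ0 : ρ p = 0 := by
    obtain ⟨v, hv⟩ := hM.tangent α p
    have h := key v
    rw [hv, Q.φ_ξ, Q.g_ξ, Q.η_ξ, if_pos rfl] at h
    simp only [map_zero, zero_apply] at h
    linear_combination -Q.ε α * h - ρ p * hε
  -- so `φ e` is orthogonal to `TM`, the orthogonal complement of `e`
  have horth : ∀ v, Q.g.val (i p) (Q.φ (i p) e) (tmap E F i p v) = 0 := by
    intro v
    have h := key v
    rw [hρ0, zero_mul] at h
    rw [Q.g.symm, ← neg_eq_zero, ← Q.g_φ_left]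
    linear_combination -Q.ε α * h - Q.g.val (i p) (Q.φ (i p) (tmap E F i p v)) e * hε
  have hprop : Q.φ (i p) e = Q.g.val (i p) (Q.φ (i p) e) (N p) • e := by
    rw [← sub_eq_zero]
    refine Q.g.nondegenerate _ _ fun u => ?_
    have hu : u - Q.g.val (i p) e u • N p ∈ LinearMap.range (tmap E F i p).toLinearMap := by
      rw [hi.mem_range_tmap_iff (hN.mem_radical p hp) (hN.ne_zero p hp), ← he, map_sub, map_smul,
        Q.g.symm _ e (N p), hN.inner_NZ p hp]
      simp
    obtain ⟨w, hw⟩ := hu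
    have h := horth w
    change tmap E F i p w = _ at hw
    rw [hw, map_sub, map_smul, smul_eq_mul] at h
    simp only [map_sub, map_smul, sub_apply, smul_apply,
      smul_eq_mul]
    linear_combination h
  -- thus `φ² e = a² e`, whereas `φ² e = -e`
  set a := Q.g.val (i p) (Q.φ (i p) e) (N p)
  rw [hprop, map_smul, hprop, smul_smul, ← add_eq_zero_iff_eq_neg] at hφφe
  have hφφe : (a * a + 1) • e = 0 := by rw [add_smul, one_smul, hφφe]
  rcases smul_eq_zero.1 hφφe with h | h
  · nlinarith [mul_self_nonneg a]
  · exact he0 h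

end Hypersurface

end LightlikeSForm

universe u v w z

open LightlikeSForm in
theorem mainTheorem4
    {E : Type u} [NormedAddCommGroup E] [NormedSpace ℝ E] [FiniteDimensional ℝ E]
    {F : Type v} [NormedAddCommGroup F] [NormedSpace ℝ F] [FiniteDimensional ℝ F]
    {Mbar : Type w} [TopologicalSpace Mbar] [ChartedSpace E Mbar] [IsManifold 𝓘(ℝ, E) ∞ Mbar]
    {n r : ℕ} (Q : IndefiniteMetricGFF E Mbar n r) (c : ℝ) (hQ : Q.IsSSpaceForm c) :
    (∀ (M : Type z) [TopologicalSpace M] [ChartedSpace F M] [IsManifold 𝓘(ℝ, F) ∞ M]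
      [Nonempty M] (i : M → Mbar)
      (S : (p : M) → Submodule ℝ (TangentSpace 𝓘(ℝ, F) p)),
      IsCharacteristic F Q i → IsScreen Q.g i S → IsTotallyUmbilical Q.g i S →
      c = ∑ α, Q.ε α) ∧
    (c ≠ ∑ α, Q.ε α →
      ¬ ∃ (M : Type z) (_ : TopologicalSpace M) (_ : ChartedSpace F M)
        (_ : IsManifold 𝓘(ℝ, F) ∞ M) (_ : Nonempty M) (i : M → Mbar)
        (S : (p : M) → Submodule ℝ (TangentSpace 𝓘(ℝ, F) p)),
        IsCharacteristic F Q i ∧ IsScreen Q.g i S ∧ IsTotallyUmbilical Q.g i S) := by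
  have hS := hQ.isSManifold
  refine ⟨fun M _ _ _ _ i S hM _ hU => (hM.not_isTotallyUmbilical hS S hU).elim, ?_⟩
  rintro - ⟨M, _, _, _, _, i, S, hM, -, hU⟩
  exact hM.not_isTotallyUmbilical hS S hU
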